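/- Let $\pi_0:\mathbb{R}\to(0,\infty)$ be a $C^1$ probability density, let $L:\mathbb{R}\to(0,\infty)$ be a $C^1$ function with $\int_{\mathbb{R}}\pi_0(u)L(u)\,du<\infty$, and let $\lambda:[0,1]\to[0,1]$ be a strictly increasing $C^1$ function with $\lambda(0)=0$ and $\lambda(1)=1$. For $t\in[0,1]$ put $$\pi_t(x)=\frac{\pi_0(x)L(x)^{\lambda(t)}}{Z(t)},\qquad Z(t)=\int_{\mathbb{R}}\pi_0(u)L(u)^{\lambda(t)}\,du ,$$ and assume that $\log L$ is $\pi_t$-integrable for every $t\in[0,1]$. Define $$f(x,t)=\frac{-\int_{-\infty}^x\partial_t\pi_t(u)\,du}{\pi_t(x)},\qquad (x,t)\in\mathbb{R}\times[0,1],$$ with one-sided time derivatives at $t=0,1$. Assume that there are $\epsilon>0$, $C$ and $R$, independent of $t$, such that $|f(x,t)|\,\pi_t(x)\le C|x|^{-1-\epsilon}$ for all $|x|\ge R$ and all $t\in[0,1]$. Then: 1. $f\in\mathcal{L}(\mathcal{C}_\pi)\cap\mathcal{E}(\mathcal{C}_\pi)$, that is: - for every $\varphi\in C^\infty$ with compact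 support contained in $\mathbb{R}\times(0,1)$, the function $(\partial_t\varphi+f\,\partial_x\varphi)\,\pi_t$ is integrable on $\mathbb{R}\times(0,1)$ and $\int_0^1\int_{\mathbb{R}}(\partial_t\varphi+f\,\partial_x\varphi)\,\pi_t(x)\,dx\,dt=0$ (the curve $(\pi_t)$ is a weak solution of the Liouville equation $\partial_t\pi_t=-\partial_x(\pi_tf)$); - $f$ is Borel, and for every compact $K\subset\mathbb{R}$ there is $M(K)>0$ with $|f(x,t)-f(y,t)|\le M(K)|x-y|$ for all $x,y\in K$ and $t\in[0,1]$; - $\int_0^1\int_{\mathbb{R}}|f(x,t)|\,\pi_t(x)\,dx\,dt<\infty$. 2. Consequently $f$ solves the flow transport problem: for $\pi_0$-almost every $x_0$ the equation $\frac{dx}{dt}=f(x,t)$, $x(0)=x_0$, has a unique solution $T_t(x_0)$ on $[0,1]$, and $\pi_t=T_{t\#}\pi_0$ for every $t\in[0,1]$. 3. For each $t\in[0,1]$, let $\mathcal{L}(\pi_t)$ be the set of $g:\mathbb{R}\to\mathbb{R}$ such that $\pi_tg$ is differentiable and $\partial_t\pi_t(x)=-\partial_x(\pi_t g)(x)$ for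 all $x$. Then $f(\cdot,t)\in\mathcal{L}(\pi_t)$, and, provided that $L^2(\pi_t)\cap\mathcal{L}(\pi_t)$ is non-empty, $f(\cdot,t)$ is the unique minimiser of the kinetic energy $$g\mapsto\frac12\int_{\mathbb{R}}g(x)^2\,\pi_t(x)\,dx$$ over $L^2(\pi_t)\cap\mathcal{L}(\pi_t)$; in particular it then lies in $L^2(\pi_t)$. -/

import Mathlib

open MeasureTheory Set
open scoped ContDiff

noncomputable section

namespace FlowTransport

/-! A curve of densities on the line is a function `p : ℝ → ℝ → ℝ`, written `p t x`, and a velocity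
field is a function `f : ℝ → ℝ → ℝ`, written `f x t`. Only the times `t ∈ [0, 1]` matter. -/

/-- The normalising constant `Z(t) = ∫ π₀(u) L(u) ^ λ(t) du`. -/
def temperedZ (π₀ L lam : ℝ → ℝ) (t : ℝ) : ℝ :=
  ∫ u, π₀ u * L u ^ lam t

/-- The tempered density `π_t(x) = π₀(x) L(x) ^ λ(t) / Z(t)`. -/
def tempered (π₀ L lam : ℝ → ℝ) (t x : ℝ) : ℝ :=
  π₀ x * L x ^ lam t / temperedZ π₀ L lam t

/-- The measure on the line with density `p t` with respect to Lebesgue measure. -/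
def curveMeasure (p : ℝ → ℝ → ℝ) (t : ℝ) : Measure ℝ :=
  volume.withDensity fun x => ENNReal.ofReal (p t x)

/-- The time derivative `∂_t p_t(x)` of the curve on `[0, 1]`, one-sided at the end points. -/
def timeDeriv (p : ℝ → ℝ → ℝ) (t x : ℝ) : ℝ :=
  derivWithin (fun s => p s x) (Icc 0 1) t

/-- The velocity field `f(x,t) = - (∫_{-∞}^x ∂_t p_t(u) du) / p_t(x)`. -/
def drift (p : ℝ → ℝ → ℝ) (x t : ℝ) : ℝ :=
  -(∫ u in Iic x, timeDeriv p t u) / p t x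

/-- The velocity fields `f` for which the curve `p` is a weak solution of the Liouville equation
`∂_t p = - ∂_x (p f)` on `ℝ × (0, 1)`. The test functions are the smooth functions with compact
support contained in `ℝ × (0, 1)`; integrability of the integrand is part of the definition. -/
def weakLiouville (p : ℝ → ℝ → ℝ) : Set (ℝ → ℝ → ℝ) :=
  {f | ∀ φ : ℝ × ℝ → ℝ, ContDiff ℝ ∞ φ → HasCompactSupport φ →
    tsupport φ ⊆ univ ×ˢ Ioo (0 : ℝ) 1 →
    IntegrableOn
      (fun z : ℝ × ℝ =>
        (deriv (fun s => φ (z.1, s)) z.2 + f z.1 z.2 * deriv (fun y => φ (y, z.2)) z.1)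
          * p z.2 z.1)
      (univ ×ˢ Ioo (0 : ℝ) 1) ∧
    ∫ t in Ioo (0 : ℝ) 1, ∫ x,
      (deriv (fun s => φ (x, s)) t + f x t * deriv (fun y => φ (y, t)) x) * p t x = 0}

/-- The regular velocity fields: `f` is Borel on `ℝ × [0, 1]`, locally Lipschitz in space uniformly
in time, and integrable in space-time against the curve `p`. -/
def regularFields (p : ℝ → ℝ → ℝ) : Set (ℝ → ℝ → ℝ) :=
  {f | Measurable (fun z : ℝ × Icc (0 : ℝ) 1 => f z.1 z.2) ∧
    (∀ K : Set ℝ, IsCompact K → ∃ M : ℝ, 0 < M ∧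
      ∀ t ∈ Icc (0 : ℝ) 1, ∀ x ∈ K, ∀ y ∈ K, |f x t - f y t| ≤ M * |x - y|) ∧
    ∫⁻ t in Icc (0 : ℝ) 1, ∫⁻ x, ENNReal.ofReal (|f x t| * p t x) < ⊤}

/-- `x` solves `dx/dt = f(x, t)` on all of `[0, 1]` with `x(0) = x₀`. -/
def IsODESolution (f : ℝ → ℝ → ℝ) (x₀ : ℝ) (x : ℝ → ℝ) : Prop :=
  x 0 = x₀ ∧ ∀ t ∈ Icc (0 : ℝ) 1, HasDerivWithinAt x (f (x t) t) (Icc 0 1) t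

/-- For almost every initial condition (under the measure at time `0`) the differential equation
`dx/dt = f(x, t)` has a unique solution on `[0, 1]`, and the flow maps `T t` push the measure at
time `0` forward to the measure at time `t`. -/
def TransportsByFlow (f p : ℝ → ℝ → ℝ) : Prop :=
  ∃ T : ℝ → ℝ → ℝ,
    (∀ᵐ x₀ ∂(curveMeasure p 0), IsODESolution f x₀ (fun t => T t x₀) ∧
      ∀ y : ℝ → ℝ, IsODESolution f x₀ y → EqOn y (fun t => T t x₀) (Icc 0 1)) ∧
    ∀ t ∈ Icc (0 : ℝ) 1, AEMeasurable (T t) (curveMeasure p 0) ∧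
      (curveMeasure p 0).map (T t) = curveMeasure p t

/-- The classical solutions `g` of the Liouville equation at time `t`: at every `x` the derivatives
`∂_t p_t(x)` and `∂_x (p_t g)(x)` exist and satisfy `∂_t p_t(x) = - ∂_x (p_t g)(x)`. -/
def classicalLiouville (p : ℝ → ℝ → ℝ) (t : ℝ) : Set (ℝ → ℝ) :=
  {g | ∀ x, ∃ q : ℝ, HasDerivWithinAt (fun s => p s x) q (Icc 0 1) t ∧
    HasDerivAt (fun y => p t y * g y) (-q) x}

/-- The classical solutions at time `t` that lie in `L²(p_t)`. -/
def finiteEnergySolutions (p : ℝ → ℝ → ℝ) (t : ℝ) : Set (ℝ → ℝ) :=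
  {g | MemLp g 2 (curveMeasure p t)} ∩ classicalLiouville p t

/-- The kinetic energy `(1/2) ∫ g(x)² p_t(x) dx`. -/
def kineticEnergy (p : ℝ → ℝ → ℝ) (t : ℝ) (g : ℝ → ℝ) : ℝ :=
  (1 / 2) * ∫ x, g x ^ 2 * p t x

/-- The set of minimisers of `E` over `S`. -/
def argmin {α : Type*} (E : α → ℝ) (S : Set α) : Set α :=
  {a | a ∈ S ∧ ∀ b ∈ S, E a ≤ E b}

end FlowTransport

end

/-!
The tempered curve `p t = π_t` is a `C¹` curve of positive densities whose densities and time
derivatives `q` are dominated by integrable functions of `x` alone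
(`exists_isDensityCurve_tempered`). Everything else holds for any such curve, and is read off the
distribution function `G(x, t) = ∫_{-∞}^x p t`: it is `C¹` on `ℝ × [0, 1]` with `∂_x G = p` and
`∂_t G = ∫_{-∞}^x q = -f p`, where `f` is the drift.

* Weak Liouville equation: `-f p` is an antiderivative of `q` in `x`, so integration by parts turns
  the pairing with a test function `φ` into `∫ d/dt (∫ φ p) = 0` (`drift_mem_weakLiouville`).
* Regularity: `f` has a jointly continuous space derivative, and `|f| p` is integrable by the tail
  hypothesis (`drift_mem_regularFields`).
* Flow: along a path `x(t)` the derivative of `G(x(t), t)` is `p (x' - f)`. Hence the solutions of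
  `x' = f(x, t)` are exactly the level curves of `G`, that is, the paths of quantiles of a fixed
  level. Each level in `(0, 1)` has exactly one quantile at each time, which gives existence and
  uniqueness from every initial point, and a map that preserves distribution functions pushes
  `p 0` forward to `p t` (`transportsByFlow`).
* Minimal energy: the flux of any other classical solution differs from `f p` by a nonzero constant,
  and is then not integrable, whereas finite energy forces integrability. So there is at most one
  solution of finite energy, the drift (`finiteEnergySolutions_subset`).
-/

namespace FlowTransport

open Filter Topology

/-! ### Integrals depending on a parameter -/

/-- Differentiation under the integral sign within a convex set of parameters, which covers
one-sided derivatives at the end points of an interval. -/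
theorem hasDerivWithinAt_integral_of_dominated {α : Type*} [MeasurableSpace α] {μ : Measure α}
    {F F' : ℝ → α → ℝ} {B : α → ℝ} {s : Set ℝ} (hs : Convex ℝ s) {t : ℝ} (ht : t ∈ s)
    (hF : ∀ τ ∈ s, Integrable (F τ) μ) (hB : Integrable B μ)
    (hbound : ∀ τ ∈ s, ∀ a, |F' τ a| ≤ B a)
    (hderiv : ∀ τ ∈ s, ∀ a, HasDerivWithinAt (fun σ => F σ a) (F' τ a) s τ) :
    HasDerivWithinAt (fun τ => ∫ a, F τ a ∂μ) (∫ a, F' t a ∂μ) s t := by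
  rw [hasDerivWithinAt_iff_tendsto_slope]
  have hmem : ∀ᶠ τ in 𝓝[s \ {t}] t, τ ∈ s \ {t} := self_mem_nhdsWithin
  have key : Tendsto (fun τ => ∫ a, slope (fun σ => F σ a) t τ ∂μ) (𝓝[s \ {t}] t)
      (𝓝 (∫ a, F' t a ∂μ)) := by
    refine tendsto_integral_filter_of_dominated_convergence B ?_ ?_ hB ?_
    · filter_upwards [hmem] with τ hτ
      simp only [slope_def_field]
      exact (((hF τ hτ.1).sub (hF t ht)).div_const _).aestronglyMeasurable
    · filter_upwards [hmem] with τ hτ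
      refine Eventually.of_forall fun a => ?_
      have h := hs.norm_image_sub_le_of_norm_hasDerivWithin_le (C := B a)
        (fun σ hσ => hderiv σ hσ a) (fun σ hσ => hbound σ hσ a) ht hτ.1
      have hne : 0 < |τ - t| := abs_pos.2 (sub_ne_zero.2 hτ.2)
      rw [slope_def_field, Real.norm_eq_abs, abs_div, div_le_iff₀ hne]
      exact h
    · exact Eventually.of_forall fun a => hasDerivWithinAt_iff_tendsto_slope.1 (hderiv t ht a)
  refine key.congr' ?_
  filter_upwards [hmem] with τ hτ
  simp only [slope_def_field]
  rw [integral_div, integral_sub (hF τ hτ.1) (hF t ht)]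

theorem continuous_slice {g : ℝ → ℝ → ℝ} {T : Set ℝ}
    (hg : ContinuousOn (fun z : ℝ × ℝ => g z.2 z.1) (univ ×ˢ T)) {t : ℝ} (ht : t ∈ T) :
    Continuous (g t) :=
  continuousOn_univ.1 (hg.comp (f := fun x : ℝ => (x, t)) (by fun_prop) fun _ _ => ⟨trivial, ht⟩)

/-- Joint continuity of `(x, t) ↦ ∫_{-∞}^x g_t` under a domination that is uniform in `t`. -/
theorem continuousOn_integral_Iic {g : ℝ → ℝ → ℝ} {B : ℝ → ℝ} {T : Set ℝ}
    (hg : ContinuousOn (fun z : ℝ × ℝ => g z.2 z.1) (univ ×ˢ T))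
    (hB : Integrable B) (hbound : ∀ t ∈ T, ∀ x, |g t x| ≤ B x) :
    ContinuousOn (fun z : ℝ × ℝ => ∫ u in Iic z.1, g z.2 u) (univ ×ˢ T) := by
  rintro ⟨x, t⟩ ⟨-, ht⟩
  simp only [← integral_indicator measurableSet_Iic]
  have hmem : ∀ᶠ z in 𝓝[univ ×ˢ T] (x, t), z.2 ∈ T := by
    filter_upwards [self_mem_nhdsWithin] with z hz using hz.2
  refine continuousWithinAt_of_dominated (bound := B) ?_ ?_ hB ?_
  · filter_upwards [hmem] with z hz
    exact ((continuous_slice hg hz).measurable.indicator measurableSet_Iic).aestronglyMeasurable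
  · filter_upwards [hmem] with z hz
    refine Eventually.of_forall fun u => ?_
    exact (norm_indicator_le_norm_self _ _).trans (hbound _ hz u)
  · -- the indicator of `Iic z.1` at `u` is locally constant in `z` near `z.1 = x` unless `u = x`
    have hne : ∀ᵐ u : ℝ, u ≠ x := by simp [ae_iff]
    filter_upwards [hne] with u hu
    have hc : ContinuousWithinAt (fun z : ℝ × ℝ => g z.2 u) (univ ×ˢ T) (x, t) :=
      (hg.comp (f := fun z : ℝ × ℝ => (u, z.2)) (by fun_prop) fun z hz => ⟨trivial, hz.2⟩) _
        ⟨trivial, ht⟩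
    rcases lt_or_gt_of_ne hu with h | h
    · refine hc.congr_of_eventuallyEq ?_ (by simp [h.le])
      have : ∀ᶠ z : ℝ × ℝ in 𝓝[univ ×ˢ T] (x, t), u < z.1 :=
        (continuous_fst.continuousWithinAt (s := univ ×ˢ T) (x := (x, t))).eventually
          (lt_mem_nhds h)
      filter_upwards [this] with z hz
      simp [hz.le]
    · refine (continuousWithinAt_const (b := (0 : ℝ))).congr_of_eventuallyEq ?_ (by simp [h])
      have : ∀ᶠ z : ℝ × ℝ in 𝓝[univ ×ˢ T] (x, t), z.1 < u :=
        (continuous_fst.continuousWithinAt (s := univ ×ˢ T) (x := (x, t))).eventually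
          (gt_mem_nhds h)
      filter_upwards [this] with z hz
      simp [hz]

theorem integral_Iic_eq_add {g : ℝ → ℝ} (hi : Integrable g) (a x : ℝ) :
    ∫ u in Iic x, g u = (∫ u in Iic a, g u) + ∫ u in a..x, g u := by
  rw [← intervalIntegral.integral_Iic_sub_Iic hi.integrableOn hi.integrableOn]
  ring

theorem hasDerivAt_integral_Iic {g : ℝ → ℝ} (hc : Continuous g) (hi : Integrable g) (x : ℝ) :
    HasDerivAt (fun x => ∫ u in Iic x, g u) (g x) x := by
  have h := (intervalIntegral.integral_hasDerivAt_right (hc.intervalIntegrable 0 x)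
    (hc.stronglyMeasurableAtFilter _ _) hc.continuousAt).const_add (∫ u in Iic 0, g u)
  exact h.congr_of_eventuallyEq (Eventually.of_forall fun y => integral_Iic_eq_add hi 0 y)

theorem tendsto_integral_Iic_atBot {g : ℝ → ℝ} (hi : Integrable g) :
    Tendsto (fun x => ∫ u in Iic x, g u) atBot (𝓝 0) := by
  have h := (intervalIntegral_tendsto_integral_Iic 0 hi.integrableOn tendsto_id).const_sub
    (∫ u in Iic 0, g u)
  rw [sub_self] at h
  refine h.congr fun x => ?_
  rw [integral_Iic_eq_add hi x 0, id, add_sub_cancel_right]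

/-! ### Curves of densities -/

/-- A `C¹` curve `p` of positive probability densities over the time interval `[0, 1]`, with time
derivative `q` and space derivative `r`, all three jointly continuous; `p` and `q` are dominated by
integrable functions of `x` that do not depend on the time. -/
structure IsDensityCurve (p q r : ℝ → ℝ → ℝ) : Prop where
  pos : ∀ t ∈ Icc (0 : ℝ) 1, ∀ x, 0 < p t x
  integral_eq_one : ∀ t ∈ Icc (0 : ℝ) 1, ∫ x, p t x = 1
  continuousOn : ContinuousOn (fun z : ℝ × ℝ => p z.2 z.1) (univ ×ˢ Icc 0 1)
  continuousOn_time : ContinuousOn (fun z : ℝ × ℝ => q z.2 z.1) (univ ×ˢ Icc 0 1)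
  continuousOn_space : ContinuousOn (fun z : ℝ × ℝ => r z.2 z.1) (univ ×ˢ Icc 0 1)
  hasDerivWithinAt_time : ∀ t ∈ Icc (0 : ℝ) 1, ∀ x,
    HasDerivWithinAt (fun s => p s x) (q t x) (Icc 0 1) t
  hasDerivAt_space : ∀ t ∈ Icc (0 : ℝ) 1, ∀ x, HasDerivAt (p t) (r t x) x
  dominated : ∃ P : ℝ → ℝ, Integrable P ∧ ∀ t ∈ Icc (0 : ℝ) 1, ∀ x, |p t x| ≤ P x
  dominated_time : ∃ Q : ℝ → ℝ, Integrable Q ∧ ∀ t ∈ Icc (0 : ℝ) 1, ∀ x, |q t x| ≤ Q x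

theorem integrable_slice {g : ℝ → ℝ → ℝ} {T : Set ℝ}
    (hg : ContinuousOn (fun z : ℝ × ℝ => g z.2 z.1) (univ ×ˢ T))
    (hB : ∃ B : ℝ → ℝ, Integrable B ∧ ∀ t ∈ T, ∀ x, |g t x| ≤ B x) {t : ℝ} (ht : t ∈ T) :
    Integrable (g t) := by
  obtain ⟨B, hB, h⟩ := hB
  exact hB.mono' (continuous_slice hg ht).aestronglyMeasurable (Eventually.of_forall (h t ht))

namespace IsDensityCurve

variable {p q r : ℝ → ℝ → ℝ} {t : ℝ}

theorem continuous_at (h : IsDensityCurve p q r) (ht : t ∈ Icc (0 : ℝ) 1) : Continuous (p t) :=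
  continuous_slice h.continuousOn ht

theorem integrable (h : IsDensityCurve p q r) (ht : t ∈ Icc (0 : ℝ) 1) : Integrable (p t) :=
  integrable_slice h.continuousOn h.dominated ht

theorem integrable_time (h : IsDensityCurve p q r) (ht : t ∈ Icc (0 : ℝ) 1) :
    Integrable (q t) :=
  integrable_slice h.continuousOn_time h.dominated_time ht

theorem continuousOn_cdf (h : IsDensityCurve p q r) :
    ContinuousOn (fun z : ℝ × ℝ => ∫ u in Iic z.1, p z.2 u) (univ ×ˢ Icc 0 1) := by
  obtain ⟨P, hP, hb⟩ := h.dominated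
  exact continuousOn_integral_Iic h.continuousOn hP hb

theorem continuousOn_integral_time (h : IsDensityCurve p q r) :
    ContinuousOn (fun z : ℝ × ℝ => ∫ u in Iic z.1, q z.2 u) (univ ×ˢ Icc 0 1) := by
  obtain ⟨Q, hQ, hb⟩ := h.dominated_time
  exact continuousOn_integral_Iic h.continuousOn_time hQ hb

theorem hasDerivAt_cdf (h : IsDensityCurve p q r) (ht : t ∈ Icc (0 : ℝ) 1) (x : ℝ) :
    HasDerivAt (fun y => ∫ u in Iic y, p t u) (p t x) x :=
  hasDerivAt_integral_Iic (h.continuous_at ht) (h.integrable ht) x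

theorem hasDerivAt_integral_time (h : IsDensityCurve p q r) (ht : t ∈ Icc (0 : ℝ) 1) (x : ℝ) :
    HasDerivAt (fun y => ∫ u in Iic y, q t u) (q t x) x :=
  hasDerivAt_integral_Iic (continuous_slice h.continuousOn_time ht) (h.integrable_time ht) x

theorem hasDerivWithinAt_cdf (h : IsDensityCurve p q r) (ht : t ∈ Icc (0 : ℝ) 1) (x : ℝ) :
    HasDerivWithinAt (fun s => ∫ u in Iic x, p s u) (∫ u in Iic x, q t u) (Icc 0 1) t := by
  obtain ⟨Q, hQ, hb⟩ := h.dominated_time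
  exact hasDerivWithinAt_integral_of_dominated (convex_Icc _ _) ht
    (fun s hs => (h.integrable hs).integrableOn) hQ.integrableOn hb h.hasDerivWithinAt_time

theorem timeDeriv_eq (h : IsDensityCurve p q r) (ht : t ∈ Icc (0 : ℝ) 1) (x : ℝ) :
    timeDeriv p t x = q t x :=
  (h.hasDerivWithinAt_time t ht x).derivWithin (uniqueDiffOn_Icc zero_lt_one t ht)

theorem drift_eq (h : IsDensityCurve p q r) (ht : t ∈ Icc (0 : ℝ) 1) (x : ℝ) :
    drift p x t = -(∫ u in Iic x, q t u) / p t x := by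
  simp only [drift, h.timeDeriv_eq ht]

/-- The flux `f p` is `-∫_{-∞}^x q`, which is minus the time derivative of the distribution
function. -/
theorem drift_mul (h : IsDensityCurve p q r) (ht : t ∈ Icc (0 : ℝ) 1) (x : ℝ) :
    drift p x t * p t x = -∫ u in Iic x, q t u := by
  rw [h.drift_eq ht, div_mul_cancel₀ _ (h.pos t ht x).ne']

/-! ### Regularity of the drift -/

theorem continuousOn_drift (h : IsDensityCurve p q r) :
    ContinuousOn (fun z : ℝ × ℝ => drift p z.1 z.2) (univ ×ˢ Icc 0 1) := by
  refine (h.continuousOn_integral_time.neg.div h.continuousOn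
    fun z hz => (h.pos _ hz.2 _).ne').congr fun z hz => ?_
  exact h.drift_eq hz.2 z.1

theorem hasDerivAt_drift (h : IsDensityCurve p q r) (ht : t ∈ Icc (0 : ℝ) 1) (x : ℝ) :
    HasDerivAt (fun y => drift p y t)
      ((-q t x * p t x - -(∫ u in Iic x, q t u) * r t x) / p t x ^ 2) x := by
  refine ((h.hasDerivAt_integral_time ht x).neg.div (h.hasDerivAt_space t ht x)
    (h.pos t ht x).ne').congr_of_eventuallyEq (Eventually.of_forall fun y => ?_)
  exact h.drift_eq ht y

/-- The space derivative of the drift is jointly continuous, hence bounded on compact sets. -/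
theorem drift_lipschitz (h : IsDensityCurve p q r) {K : Set ℝ} (hK : IsCompact K) :
    ∃ M : ℝ, 0 < M ∧ ∀ t ∈ Icc (0 : ℝ) 1, ∀ x ∈ K, ∀ y ∈ K,
      |drift p x t - drift p y t| ≤ M * |x - y| := by
  obtain ⟨R, hR⟩ := hK.isBounded.subset_closedBall 0
  have hcont : ContinuousOn (fun z : ℝ × ℝ =>
      (-q z.2 z.1 * p z.2 z.1 - -(∫ u in Iic z.1, q z.2 u) * r z.2 z.1) / p z.2 z.1 ^ 2)
      (univ ×ˢ Icc 0 1) :=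
    ((h.continuousOn_time.neg.mul h.continuousOn).sub
      (h.continuousOn_integral_time.neg.mul h.continuousOn_space)).div (h.continuousOn.pow 2)
      fun z hz => pow_ne_zero 2 (h.pos _ hz.2 _).ne'
  obtain ⟨M, hM⟩ := ((isCompact_closedBall (0 : ℝ) R).prod
    (isCompact_Icc (a := (0 : ℝ)) (b := 1))).exists_bound_of_continuousOn
      (hcont.mono (prod_mono_left (subset_univ _)))
  refine ⟨max M 1, by positivity, fun t ht x hx y hy => ?_⟩
  exact (convex_closedBall (0 : ℝ) R).norm_image_sub_le_of_norm_hasDerivWithin_le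
    (fun w _ => (h.hasDerivAt_drift ht w).hasDerivWithinAt)
    (fun w hw => (hM (w, t) ⟨hw, ht⟩).trans (le_max_left _ _)) (hR hy) (hR hx)

theorem drift_mem_regularFields (h : IsDensityCurve p q r)
    (htail : ∃ ε : ℝ, 0 < ε ∧ ∃ C R : ℝ, ∀ t ∈ Icc (0 : ℝ) 1, ∀ x : ℝ, R ≤ |x| →
      |drift p x t| * p t x ≤ C * |x| ^ (-1 - ε)) :
    drift p ∈ regularFields p := by
  refine ⟨?_, fun K hK => h.drift_lipschitz hK, ?_⟩
  · exact (h.continuousOn_drift.comp_continuous (f := fun z : ℝ × Icc (0 : ℝ) 1 => (z.1, (z.2 : ℝ)))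
      (by fun_prop) fun z => ⟨trivial, z.2.2⟩).measurable
  · obtain ⟨ε, hε, C, R, hC⟩ := htail
    obtain ⟨M, hM⟩ := ((isCompact_closedBall (0 : ℝ) (max R 1)).prod
      (isCompact_Icc (a := (0 : ℝ)) (b := 1))).exists_bound_of_continuousOn
        ((h.continuousOn_drift.mul h.continuousOn).mono (prod_mono_left (subset_univ _)))
    -- `|f| p` is dominated by a multiple of the integrable function `w`: by compactness for
    -- `|x| ≤ max R 1`, by the tail bound beyond
    set w : ℝ → ℝ := fun x => (1 + |x|) ^ (-(1 + ε)) with hw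
    have hw0 : ∀ x, 0 < w x := fun x => Real.rpow_pos_of_pos (by positivity) _
    have hwi : Integrable w := by
      have := integrable_one_add_norm (E := ℝ) (μ := volume) (r := 1 + ε) (by simp [hε])
      simpa [hw] using this
    set a : ℝ := max M 0 * (1 + max R 1) ^ (1 + ε) with ha
    set b : ℝ := max C 0 * 2 ^ (1 + ε) with hb
    have ha0 : 0 ≤ a := by positivity
    have hb0 : 0 ≤ b := by positivity
    have key : ∀ t ∈ Icc (0 : ℝ) 1, ∀ x, |drift p x t| * p t x ≤ (a + b) * w x := by
      intro t ht x
      rcases le_total |x| (max R 1) with hx | hx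
      · have h1 : |drift p x t| * p t x ≤ max M 0 := by
          have := hM (x, t) ⟨by simpa using hx, ht⟩
          rw [Pi.mul_apply, Real.norm_eq_abs, abs_mul, abs_of_pos (h.pos t ht x)] at this
          exact this.trans (le_max_left _ _)
        have h2 : 1 ≤ (1 + max R 1) ^ (1 + ε) * w x := by
          rw [hw]
          simp only
          rw [Real.rpow_neg (by positivity), ← div_eq_mul_inv, one_le_div (by positivity)]
          gcongr
        calc _ ≤ max M 0 * 1 := by simpa using h1
          _ ≤ max M 0 * ((1 + max R 1) ^ (1 + ε) * w x) := by gcongr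
          _ = a * w x := by rw [ha]; ring
          _ ≤ _ := by have := (hw0 x).le; gcongr; linarith
      · have hx1 : 1 ≤ |x| := (le_max_right _ _).trans hx
        have h1 := hC t ht x ((le_max_left _ _).trans hx)
        have h2 : |x| ^ (-1 - ε) ≤ 2 ^ (1 + ε) * w x := by
          rw [show -1 - ε = -(1 + ε) by ring, hw]
          simp only
          rw [Real.rpow_neg (by positivity), Real.rpow_neg (by positivity), ← div_eq_mul_inv,
            ← Real.div_rpow (by positivity) (by positivity), ← Real.inv_rpow (by positivity)]
          gcongr
          rw [inv_eq_one_div, div_le_div_iff₀ (by positivity) (by positivity)]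
          linarith
        calc _ ≤ C * |x| ^ (-1 - ε) := h1
          _ ≤ max C 0 * |x| ^ (-1 - ε) := by gcongr; exact le_max_left _ _
          _ ≤ max C 0 * (2 ^ (1 + ε) * w x) := by gcongr
          _ = b * w x := by rw [hb]; ring
          _ ≤ _ := by have := (hw0 x).le; gcongr; linarith
    calc ∫⁻ t in Icc (0 : ℝ) 1, ∫⁻ x, ENNReal.ofReal (|drift p x t| * p t x)
        ≤ ∫⁻ _ in Icc (0 : ℝ) 1, ∫⁻ x, ENNReal.ofReal ((a + b) * w x) := by
          refine setLIntegral_mono' measurableSet_Icc fun t ht => lintegral_mono fun x => ?_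
          exact ENNReal.ofReal_le_ofReal (key t ht x)
      _ < ⊤ := by
          have := (hwi.const_mul (a + b)).lintegral_lt_top
          simpa using this

/-! ### Classical solutions and kinetic energy -/

theorem drift_mem_classicalLiouville (h : IsDensityCurve p q r) (ht : t ∈ Icc (0 : ℝ) 1) :
    (fun x => drift p x t) ∈ classicalLiouville p t := by
  intro x
  refine ⟨q t x, h.hasDerivWithinAt_time t ht x, ?_⟩
  refine (h.hasDerivAt_integral_time ht x).neg.congr_of_eventuallyEq
    (Eventually.of_forall fun y => ?_)
  simp only [mul_comm (p t y), h.drift_mul ht, Pi.neg_apply]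

theorem isProbabilityMeasure (h : IsDensityCurve p q r) (ht : t ∈ Icc (0 : ℝ) 1) :
    IsProbabilityMeasure (curveMeasure p t) := by
  constructor
  rw [curveMeasure, withDensity_apply _ MeasurableSet.univ, Measure.restrict_univ,
    ← ofReal_integral_eq_lintegral_ofReal (h.integrable ht)
      (Eventually.of_forall fun x => (h.pos t ht x).le), h.integral_eq_one t ht, ENNReal.ofReal_one]

/-- The drift is the only classical solution of finite energy. The flux `p g` of any such solution
differs from that of the drift by a constant `c`, hence tends to `c` at `-∞`. By Cauchy–Schwarz
`p g` is integrable, so `c = 0`. -/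
theorem finiteEnergySolutions_subset (h : IsDensityCurve p q r) (ht : t ∈ Icc (0 : ℝ) 1) :
    finiteEnergySolutions p t ⊆ {fun x => drift p x t} := by
  rintro g ⟨hg2, hg⟩
  have := h.isProbabilityMeasure ht
  have hgp : Integrable fun x => p t x * g x := by
    have := hg2.integrable one_le_two
    rw [curveMeasure, integrable_withDensity_iff_integrable_smul'
      (h.continuous_at ht).measurable.ennreal_ofReal (by simp)] at this
    refine this.congr (Eventually.of_forall fun x => ?_)
    simp [ENNReal.toReal_ofReal (h.pos t ht x).le]
  -- `p g` and `p f` have the same derivative, hence differ by a constant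
  have hderiv : ∀ x, HasDerivAt (fun y => p t y * g y + ∫ u in Iic y, q t u) 0 x := by
    intro x
    obtain ⟨v, hv, hgv⟩ := hg x
    have hvq : v = q t x := (uniqueDiffOn_Icc zero_lt_one t ht).eq_deriv _ hv
      (h.hasDerivWithinAt_time t ht x)
    have := hgv.add (h.hasDerivAt_integral_time ht x)
    rwa [hvq, neg_add_cancel] at this
  obtain ⟨c, hc⟩ : ∃ c, ∀ x, p t x * g x + ∫ u in Iic x, q t u = c :=
    ⟨_, fun x => is_const_of_deriv_eq_zero (fun x => (hderiv x).differentiableAt)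
      (fun x => (hderiv x).deriv) x 0⟩
  have hlim : Tendsto (fun x => p t x * g x) atBot (𝓝 c) := by
    have := (tendsto_integral_Iic_atBot (h.integrable_time ht)).const_sub c
    rw [sub_zero] at this
    exact this.congr fun x => by rw [← hc x]; ring
  -- an integrable function cannot have a nonzero limit at `-∞`
  have hc0 : c = 0 := by
    by_contra hne
    have hev : ∀ᶠ x in atBot, |c| / 2 < |p t x * g x| :=
      hlim.abs.eventually (lt_mem_nhds (by linarith [abs_pos.2 hne]))
    obtain ⟨a, ha⟩ := eventually_atBot.1 hev
    have hint : IntegrableOn (fun _ : ℝ => |c| / 2) (Iic a) := by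
      refine hgp.norm.integrableOn.mono' (by fun_prop) ?_
      filter_upwards [ae_restrict_mem measurableSet_Iic] with x hx
      rw [Real.norm_of_nonneg (by positivity)]
      exact (ha x hx).le
    rw [integrableOn_const_iff] at hint
    simp [hne] at hint
  funext x
  have hx := hc x
  rw [hc0] at hx
  have hp := (h.pos t ht x).ne'
  rw [h.drift_eq ht, eq_div_iff hp]
  linarith

theorem argmin_kineticEnergy (h : IsDensityCurve p q r) (ht : t ∈ Icc (0 : ℝ) 1)
    (hne : (finiteEnergySolutions p t).Nonempty) :
    argmin (kineticEnergy p t) (finiteEnergySolutions p t) = {fun x => drift p x t} := by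
  rw [hne.subset_singleton_iff.1 (h.finiteEnergySolutions_subset ht)]
  ext g
  constructor
  · exact fun hg => hg.1
  · rintro rfl
    exact ⟨rfl, fun b hb => by rw [mem_singleton_iff.1 hb]⟩

end IsDensityCurve

/-! ### The weak Liouville equation -/

theorem hasCompactSupport_slice {ψ : ℝ × ℝ → ℝ} (hψ : HasCompactSupport ψ) (t : ℝ) :
    HasCompactSupport fun x => ψ (x, t) :=
  HasCompactSupport.intro (hψ.isCompact.image continuous_fst) fun x hx =>
    image_eq_zero_of_notMem_tsupport fun h => hx ⟨(x, t), h, rfl⟩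

theorem hasDerivAt_fst {φ : ℝ × ℝ → ℝ} (hφ : ContDiff ℝ ∞ φ) (z : ℝ × ℝ) :
    HasDerivAt (fun y => φ (y, z.2)) (fderiv ℝ φ z (1, 0)) z.1 :=
  ((hφ.differentiable (by simp)) z).hasFDerivAt.comp_hasDerivAt z.1
    ((hasDerivAt_id z.1).prodMk (hasDerivAt_const z.1 z.2))

theorem hasDerivAt_snd {φ : ℝ × ℝ → ℝ} (hφ : ContDiff ℝ ∞ φ) (z : ℝ × ℝ) :
    HasDerivAt (fun s => φ (z.1, s)) (fderiv ℝ φ z (0, 1)) z.2 :=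
  ((hφ.differentiable (by simp)) z).hasFDerivAt.comp_hasDerivAt z.2
    ((hasDerivAt_const z.2 z.1).prodMk (hasDerivAt_id z.2))

namespace IsDensityCurve

variable {p q r : ℝ → ℝ → ℝ} {t : ℝ}

/-- Integration by parts in space turns the pairing with a test function `φ` at time `t` into the
derivative of `t ↦ ∫ φ(x, t) p_t(x) dx`, which vanishes at both end points. -/
theorem drift_mem_weakLiouville (h : IsDensityCurve p q r) : drift p ∈ weakLiouville p := by
  intro φ hφ hφc hφs
  have hcurry : ∀ x t, deriv (fun y => φ (y, t)) x = fderiv ℝ φ (x, t) (1, 0) :=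
    fun x t => (hasDerivAt_fst hφ (x, t)).deriv
  have hcurry' : ∀ x t, deriv (fun s => φ (x, s)) t = fderiv ℝ φ (x, t) (0, 1) :=
    fun x t => (hasDerivAt_snd hφ (x, t)).deriv
  simp only [hcurry, hcurry']
  have hfc : Continuous (fderiv ℝ φ) := hφ.continuous_fderiv (by simp)
  set X : ℝ × ℝ → ℝ := fun z => fderiv ℝ φ z (1, 0) with hX
  set Y : ℝ × ℝ → ℝ := fun z => fderiv ℝ φ z (0, 1) with hY
  have hXc : Continuous X := by fun_prop
  have hYc : Continuous Y := by fun_prop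
  have hXs : HasCompactSupport X := hφc.fderiv_apply (𝕜 := ℝ) (1, 0)
  have hYs : HasCompactSupport Y := hφc.fderiv_apply (𝕜 := ℝ) (0, 1)
  change IntegrableOn (fun z : ℝ × ℝ => (Y z + drift p z.1 z.2 * X z) * p z.2 z.1) _ ∧
    ∫ t in Ioo (0 : ℝ) 1, ∫ x, (Y (x, t) + drift p x t * X (x, t)) * p t x = 0
  constructor
  · have hcont : ContinuousOn (fun z : ℝ × ℝ => (Y z + drift p z.1 z.2 * X z) * p z.2 z.1)
        (univ ×ˢ Icc 0 1) :=
      (hYc.continuousOn.add (h.continuousOn_drift.mul hXc.continuousOn)).mul h.continuousOn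
    have hsub : tsupport φ ⊆ univ ×ˢ Icc (0 : ℝ) 1 :=
      hφs.trans (prod_mono_right Ioo_subset_Icc_self)
    refine Integrable.integrableOn ((integrableOn_iff_integrable_of_support_subset ?_).1
      ((hcont.mono hsub).integrableOn_compact hφc.isCompact))
    intro z hz
    by_contra hzn
    have h0 : fderiv ℝ φ z = 0 := fderiv_of_notMem_tsupport ℝ hzn
    simp [hX, hY, h0] at hz
  · have hspace : ∀ t ∈ Icc (0 : ℝ) 1, ∫ x, (Y (x, t) + drift p x t * X (x, t)) * p t x =
        ∫ x, (Y (x, t) * p t x + φ (x, t) * q t x) := by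
      intro t ht
      have hslice : Continuous fun x : ℝ => (x, t) := by fun_prop
      have hcJ : Continuous fun x => ∫ u in Iic x, q t u :=
        continuous_slice (g := fun t x => ∫ u in Iic x, q t u) h.continuousOn_integral_time ht
      have hcq := continuous_slice h.continuousOn_time ht
      have hI1 : Integrable fun x => Y (x, t) * p t x :=
        ((hYc.comp hslice).mul (h.continuous_at ht)).integrable_of_hasCompactSupport
          (hasCompactSupport_slice hYs t).mul_right
      have hI2 : Integrable fun x => φ (x, t) * q t x :=
        ((hφ.continuous.comp hslice).mul hcq).integrable_of_hasCompactSupport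
          (hasCompactSupport_slice hφc t).mul_right
      have hI3 : Integrable fun x => X (x, t) * ∫ u in Iic x, q t u :=
        ((hXc.comp hslice).mul hcJ).integrable_of_hasCompactSupport
          (hasCompactSupport_slice hXs t).mul_right
      have hI4 : Integrable fun x => φ (x, t) * ∫ u in Iic x, q t u :=
        ((hφ.continuous.comp hslice).mul hcJ).integrable_of_hasCompactSupport
          (hasCompactSupport_slice hφc t).mul_right
      have hzero : ∫ x, (X (x, t) * (∫ u in Iic x, q t u) + φ (x, t) * q t x) = 0 :=
        integral_eq_zero_of_hasDerivAt_of_integrable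
          (fun x => (hasDerivAt_fst hφ (x, t)).mul (h.hasDerivAt_integral_time ht x))
          (hI3.add hI2) hI4
      have hsub := integral_sub (hI1.add hI2) (hI3.add hI2)
      simp only [Pi.add_apply] at hsub
      rw [hzero, sub_zero] at hsub
      rw [← hsub]
      congr 1
      funext x
      rw [add_mul, mul_right_comm, h.drift_mul ht]
      ring
    rw [setIntegral_congr_fun measurableSet_Ioo fun t ht => hspace t (Ioo_subset_Icc_self ht),
      ← integral_Ioc_eq_integral_Ioo, ← intervalIntegral.integral_of_le zero_le_one]
    obtain ⟨P, hP, hPb⟩ := h.dominated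
    obtain ⟨Q, hQ, hQb⟩ := h.dominated_time
    obtain ⟨a, ha⟩ := hYs.exists_bound_of_continuous hYc
    obtain ⟨b, hb⟩ := hφc.exists_bound_of_continuous hφ.continuous
    have hB : Integrable fun x => a * P x + b * Q x := (hP.const_mul a).add (hQ.const_mul b)
    have hbound : ∀ t ∈ Icc (0 : ℝ) 1, ∀ x,
        |Y (x, t) * p t x + φ (x, t) * q t x| ≤ a * P x + b * Q x := by
      intro t ht x
      refine (abs_add_le _ _).trans ?_
      rw [abs_mul, abs_mul]
      exact add_le_add
        (mul_le_mul (ha _) (hPb t ht x) (abs_nonneg _) ((norm_nonneg _).trans (ha (x, t))))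
        (mul_le_mul (hb _) (hQb t ht x) (abs_nonneg _) ((norm_nonneg _).trans (hb (x, t))))
    have hFi : ∀ t ∈ Icc (0 : ℝ) 1, Integrable fun x => φ (x, t) * p t x := fun t ht =>
      ((hφ.continuous.comp (by fun_prop : Continuous fun x : ℝ => (x, t))).mul
        (h.continuous_at ht)).integrable_of_hasCompactSupport
          (hasCompactSupport_slice hφc t).mul_right
    have hW : ∀ t ∈ Icc (0 : ℝ) 1, HasDerivWithinAt (fun t => ∫ x, φ (x, t) * p t x)
        (∫ x, (Y (x, t) * p t x + φ (x, t) * q t x)) (Icc 0 1) t := by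
      intro t ht
      exact hasDerivWithinAt_integral_of_dominated (convex_Icc _ _) ht hFi hB hbound
        fun s hs x => (hasDerivAt_snd hφ (x, s)).hasDerivWithinAt.mul
          (h.hasDerivWithinAt_time s hs x)
    have hjoint : ContinuousOn (fun z : ℝ × ℝ => Y z * p z.2 z.1 + φ z * q z.2 z.1)
        (univ ×ˢ Icc 0 1) :=
      (hYc.continuousOn.mul h.continuousOn).add (hφ.continuous.continuousOn.mul h.continuousOn_time)
    have hWc : ContinuousOn (fun t => ∫ x, (Y (x, t) * p t x + φ (x, t) * q t x))
        (Icc (0 : ℝ) 1) := by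
      refine continuousOn_of_dominated (bound := fun x => a * P x + b * Q x) (fun t ht => ?_)
        (fun t ht => Eventually.of_forall (hbound t ht)) hB (Eventually.of_forall fun x => ?_)
      · exact (hjoint.comp_continuous (f := fun x : ℝ => (x, t)) (by fun_prop)
          fun x => ⟨trivial, ht⟩).aestronglyMeasurable
      · exact hjoint.comp (f := fun t : ℝ => (x, t)) (by fun_prop) fun t ht => ⟨trivial, ht⟩
    rw [intervalIntegral.integral_eq_sub_of_hasDerivAt_of_le zero_le_one
      (fun t ht => (hW t ht).continuousWithinAt)
      (fun t ht => (hW t (Ioo_subset_Icc_self ht)).hasDerivAt (Icc_mem_nhds ht.1 ht.2))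
      (hWc.intervalIntegrable_of_Icc zero_le_one)]
    have h0 : ∀ x, φ (x, 0) = 0 := fun x =>
      image_eq_zero_of_notMem_tsupport fun hx => lt_irrefl _ (hφs hx).2.1
    have h1 : ∀ x, φ (x, 1) = 0 := fun x =>
      image_eq_zero_of_notMem_tsupport fun hx => lt_irrefl _ (hφs hx).2.2
    simp [h0, h1]

/-! ### Quantiles and the flow -/

theorem strictMono_cdf (h : IsDensityCurve p q r) (ht : t ∈ Icc (0 : ℝ) 1) :
    StrictMono fun x => ∫ u in Iic x, p t u :=
  strictMono_of_deriv_pos fun x => by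
    rw [(h.hasDerivAt_cdf ht x).deriv]
    exact h.pos t ht x

theorem tendsto_cdf_atTop (h : IsDensityCurve p q r) (ht : t ∈ Icc (0 : ℝ) 1) :
    Tendsto (fun x => ∫ u in Iic x, p t u) atTop (𝓝 1) := by
  rw [← h.integral_eq_one t ht]
  exact (aecover_Iic tendsto_id).integral_tendsto_of_countably_generated (h.integrable ht)

theorem cdf_mem_Ioo (h : IsDensityCurve p q r) (ht : t ∈ Icc (0 : ℝ) 1) (x : ℝ) :
    ∫ u in Iic x, p t u ∈ Ioo (0 : ℝ) 1 := by
  have hm := h.strictMono_cdf ht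
  constructor
  · exact (hm.monotone.le_of_tendsto (tendsto_integral_Iic_atBot (h.integrable ht))
      (x - 1)).trans_lt
      (hm (by linarith))
  · exact (hm (lt_add_one x)).trans_le (hm.monotone.ge_of_tendsto (h.tendsto_cdf_atTop ht) (x + 1))

theorem exists_cdf_eq (h : IsDensityCurve p q r) (ht : t ∈ Icc (0 : ℝ) 1) {c : ℝ}
    (hc : c ∈ Ioo (0 : ℝ) 1) : ∃ x, ∫ u in Iic x, p t u = c := by
  refine mem_range_of_exists_le_of_exists_ge
    (continuous_iff_continuousAt.2 fun x => (h.hasDerivAt_cdf ht x).continuousAt) ?_ ?_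
  · obtain ⟨a, ha⟩ := ((tendsto_integral_Iic_atBot (h.integrable ht)).eventually
      (gt_mem_nhds hc.1)).exists
    exact ⟨a, ha.le⟩
  · obtain ⟨a, ha⟩ := ((h.tendsto_cdf_atTop ht).eventually (lt_mem_nhds hc.2)).exists
    exact ⟨a, ha.le⟩

theorem curveMeasure_Iic (h : IsDensityCurve p q r) (ht : t ∈ Icc (0 : ℝ) 1) (x : ℝ) :
    curveMeasure p t (Iic x) = ENNReal.ofReal (∫ u in Iic x, p t u) := by
  rw [curveMeasure, withDensity_apply _ measurableSet_Iic,
    ← ofReal_integral_eq_lintegral_ofReal (h.integrable ht).integrableOn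
      (Eventually.of_forall fun x => (h.pos t ht x).le)]

theorem exists_cdf_sub_eq (h : IsDensityCurve p q r) (ht : t ∈ Icc (0 : ℝ) 1) (a b : ℝ) :
    ∃ ξ, |ξ - a| ≤ |b - a| ∧
      (∫ u in Iic b, p t u) - (∫ u in Iic a, p t u) = p t ξ * (b - a) := by
  have hc : Continuous fun x => ∫ u in Iic x, p t u :=
    continuous_iff_continuousAt.2 fun x => (h.hasDerivAt_cdf ht x).continuousAt
  rcases lt_trichotomy a b with hab | rfl | hab
  · obtain ⟨ξ, hξ, he⟩ := exists_hasDerivAt_eq_slope _ _ hab hc.continuousOn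
      fun x _ => h.hasDerivAt_cdf ht x
    refine ⟨ξ, ?_, ?_⟩
    · rw [abs_of_pos (sub_pos.2 hξ.1), abs_of_pos (sub_pos.2 hab)]
      linarith [hξ.2]
    · rw [he, div_mul_cancel₀ _ (sub_pos.2 hab).ne']
  · exact ⟨a, by simp, by simp⟩
  · obtain ⟨ξ, hξ, he⟩ := exists_hasDerivAt_eq_slope _ _ hab hc.continuousOn
      fun x _ => h.hasDerivAt_cdf ht x
    refine ⟨ξ, ?_, ?_⟩
    · rw [abs_of_neg (sub_neg.2 hξ.2), abs_of_neg (sub_neg.2 hab)]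
      linarith [hξ.1]
    · rw [he, ← neg_sub a b, mul_neg, div_mul_cancel₀ _ (sub_pos.2 hab).ne', neg_sub]

/-- Along a continuous path `τ`, the space increment of the distribution function is `m(t)` times
the increment of `τ`, with `m(t) > 0` tending to the density at `τ t₀`. This replaces total
differentiability of the distribution function at the boundary of `ℝ × [0, 1]`, both in the chain
rule and in the implicit function argument. -/
theorem exists_cdf_increment (h : IsDensityCurve p q r) {τ : ℝ → ℝ} {t₀ : ℝ}
    (ht₀ : t₀ ∈ Icc (0 : ℝ) 1) (hτ : ContinuousWithinAt τ (Icc 0 1) t₀) :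
    ∃ m : ℝ → ℝ, Tendsto m (𝓝[Icc 0 1] t₀) (𝓝 (p t₀ (τ t₀))) ∧
      (∀ t ∈ Icc (0 : ℝ) 1, 0 < m t) ∧
      ∀ t ∈ Icc (0 : ℝ) 1, (∫ u in Iic (τ t), p t u) - (∫ u in Iic (τ t₀), p t u) =
        m t * (τ t - τ t₀) := by
  have hex : ∀ t, t ∈ Icc (0 : ℝ) 1 → ∃ ξ, |ξ - τ t₀| ≤ |τ t - τ t₀| ∧
      (∫ u in Iic (τ t), p t u) - (∫ u in Iic (τ t₀), p t u) = p t ξ * (τ t - τ t₀) :=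
    fun t ht => h.exists_cdf_sub_eq ht _ _
  choose! ξ hξ hξe using hex
  refine ⟨fun t => p t (ξ t), ?_, fun t ht => h.pos t ht _, hξe⟩
  have hmem : ∀ᶠ t in 𝓝[Icc (0 : ℝ) 1] t₀, t ∈ Icc (0 : ℝ) 1 := self_mem_nhdsWithin
  have hξt : Tendsto ξ (𝓝[Icc 0 1] t₀) (𝓝 (τ t₀)) := by
    have h0 : Tendsto (fun t => |τ t - τ t₀|) (𝓝[Icc 0 1] t₀) (𝓝 0) := by
      simpa using (hτ.tendsto.sub_const (τ t₀)).abs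
    rw [tendsto_iff_norm_sub_tendsto_zero]
    refine squeeze_zero' (Eventually.of_forall fun t => norm_nonneg _) ?_ h0
    filter_upwards [hmem] with t ht using hξ t ht
  have hpair : Tendsto (fun t => (ξ t, t)) (𝓝[Icc 0 1] t₀)
      (𝓝[univ ×ˢ Icc 0 1] (τ t₀, t₀)) := by
    refine tendsto_nhdsWithin_iff.2 ⟨?_, ?_⟩
    · exact hξt.prodMk_nhds (tendsto_id.mono_left nhdsWithin_le_nhds)
    · filter_upwards [hmem] with t ht using ⟨trivial, ht⟩
  exact (h.continuousOn (τ t₀, t₀) ⟨trivial, ht₀⟩).tendsto.comp hpair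

/-- Chain rule for the distribution function along a differentiable path. -/
theorem hasDerivWithinAt_cdf_comp (h : IsDensityCurve p q r) {τ : ℝ → ℝ} {v t₀ : ℝ}
    (ht₀ : t₀ ∈ Icc (0 : ℝ) 1) (hτ : HasDerivWithinAt τ v (Icc 0 1) t₀) :
    HasDerivWithinAt (fun t => ∫ u in Iic (τ t), p t u)
      (p t₀ (τ t₀) * v + ∫ u in Iic (τ t₀), q t₀ u) (Icc 0 1) t₀ := by
  obtain ⟨m, hm, -, hme⟩ := h.exists_cdf_increment ht₀ hτ.continuousWithinAt
  have hs := (h.hasDerivWithinAt_cdf ht₀ (τ t₀))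
  rw [hasDerivWithinAt_iff_tendsto_slope] at hτ hs ⊢
  refine (((hm.mono_left (nhdsWithin_mono _ sdiff_subset)).mul hτ).add hs).congr' ?_
  filter_upwards [self_mem_nhdsWithin] with t ht
  simp only [slope_def_field]
  rw [← sub_add_sub_cancel (∫ u in Iic (τ t), p t u) (∫ u in Iic (τ t₀), p t u), hme t ht.1]
  ring

/-- Implicit differentiation: a continuous path of quantiles follows the drift. -/
theorem hasDerivWithinAt_of_cdf_const (h : IsDensityCurve p q r) {τ : ℝ → ℝ} {c t₀ : ℝ}
    (ht₀ : t₀ ∈ Icc (0 : ℝ) 1) (hτ : ContinuousWithinAt τ (Icc 0 1) t₀)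
    (hc : ∀ t ∈ Icc (0 : ℝ) 1, ∫ u in Iic (τ t), p t u = c) :
    HasDerivWithinAt τ (drift p (τ t₀) t₀) (Icc 0 1) t₀ := by
  obtain ⟨m, hm, hm0, hme⟩ := h.exists_cdf_increment ht₀ hτ
  have hs := (h.hasDerivWithinAt_cdf ht₀ (τ t₀))
  rw [hasDerivWithinAt_iff_tendsto_slope] at hs ⊢
  rw [h.drift_eq ht₀]
  refine (hs.neg.div (hm.mono_left (nhdsWithin_mono _ sdiff_subset))
    (h.pos _ ht₀ _).ne').congr' ?_
  filter_upwards [self_mem_nhdsWithin] with t ht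
  have hmt := (hm0 t ht.1).ne'
  have he := hme t ht.1
  rw [hc t ht.1, ← hc t₀ ht₀] at he
  simp only [slope_def_field, Pi.div_apply]
  rw [div_eq_iff hmt, ← neg_div, neg_sub, he]
  ring

/-- A path of quantiles of a fixed level is continuous, because the distribution functions are
strictly increasing in space and continuous in time. -/
theorem continuousWithinAt_of_cdf_const (h : IsDensityCurve p q r) {τ : ℝ → ℝ} {c t₀ : ℝ}
    (ht₀ : t₀ ∈ Icc (0 : ℝ) 1) (hc : ∀ t ∈ Icc (0 : ℝ) 1, ∫ u in Iic (τ t), p t u = c) :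
    ContinuousWithinAt τ (Icc 0 1) t₀ := by
  have hmem : ∀ᶠ t in 𝓝[Icc (0 : ℝ) 1] t₀, t ∈ Icc (0 : ℝ) 1 := self_mem_nhdsWithin
  have hcont : ∀ x, Tendsto (fun t => ∫ u in Iic x, p t u) (𝓝[Icc 0 1] t₀)
      (𝓝 (∫ u in Iic x, p t₀ u)) := fun x => (h.hasDerivWithinAt_cdf ht₀ x).continuousWithinAt
  refine tendsto_order.2 ⟨fun a ha => ?_, fun b hb => ?_⟩
  · have hlt : ∫ u in Iic a, p t₀ u < c := hc t₀ ht₀ ▸ h.strictMono_cdf ht₀ ha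
    filter_upwards [hmem, (hcont a).eventually (gt_mem_nhds hlt)] with t ht hlt'
    rw [← hc t ht] at hlt'
    exact (h.strictMono_cdf ht).lt_iff_lt.1 hlt'
  · have hlt : c < ∫ u in Iic b, p t₀ u := hc t₀ ht₀ ▸ h.strictMono_cdf ht₀ hb
    filter_upwards [hmem, (hcont b).eventually (lt_mem_nhds hlt)] with t ht hlt'
    rw [← hc t ht] at hlt'
    exact (h.strictMono_cdf ht).lt_iff_lt.1 hlt'

/-- The distribution function is constant along the trajectories of the drift. -/
theorem cdf_eq_of_isODESolution (h : IsDensityCurve p q r) {x₀ : ℝ} {y : ℝ → ℝ}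
    (hy : IsODESolution (drift p) x₀ y) (ht : t ∈ Icc (0 : ℝ) 1) :
    ∫ u in Iic (y t), p t u = ∫ u in Iic x₀, p 0 u := by
  have hd : ∀ s ∈ Icc (0 : ℝ) 1,
      HasDerivWithinAt (fun t => ∫ u in Iic (y t), p t u) 0 (Icc 0 1) s := by
    intro s hs
    convert h.hasDerivWithinAt_cdf_comp hs (hy.2 s hs) using 1
    rw [mul_comm, h.drift_mul hs, neg_add_cancel]
  have := (convex_Icc (0 : ℝ) 1).norm_image_sub_le_of_norm_hasDerivWithin_le (C := 0) hd
    (fun s _ => by simp) (left_mem_Icc.2 zero_le_one) ht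
  rw [zero_mul, norm_le_zero_iff, sub_eq_zero, hy.1] at this
  exact this

/-- The flow map sends `x` to the point `T_t x` with `∫_{-∞}^{T_t x} p_t = ∫_{-∞}^x p_0`, that is,
it is the monotone rearrangement of `p_0` into `p_t`. -/
theorem transportsByFlow (h : IsDensityCurve p q r) : TransportsByFlow (drift p) p := by
  have h0 : (0 : ℝ) ∈ Icc (0 : ℝ) 1 := left_mem_Icc.2 zero_le_one
  have hex : ∀ t x, t ∈ Icc (0 : ℝ) 1 → ∃ y, ∫ u in Iic y, p t u = ∫ u in Iic x, p 0 u :=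
    fun t x ht => h.exists_cdf_eq ht (h.cdf_mem_Ioo h0 x)
  choose! T hT using hex
  refine ⟨T, Eventually.of_forall fun x₀ => ⟨⟨?_, fun t ht => ?_⟩, fun y hy t ht => ?_⟩,
    fun t ht => ?_⟩
  · exact (h.strictMono_cdf h0).injective (hT 0 x₀ h0)
  · exact h.hasDerivWithinAt_of_cdf_const (τ := fun t => T t x₀) ht
      (h.continuousWithinAt_of_cdf_const ht fun s hs => hT s x₀ hs) fun s hs => hT s x₀ hs
  · refine (h.strictMono_cdf ht).injective ?_
    simp only [hT t x₀ ht, h.cdf_eq_of_isODESolution hy ht]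
  · have hmono : Monotone (T t) := fun x y hxy => by
      rw [← (h.strictMono_cdf ht).le_iff_le]
      simp only [hT t _ ht]
      exact (h.strictMono_cdf h0).monotone hxy
    have hmeas : Measurable (T t) := hmono.measurable
    refine ⟨hmeas.aemeasurable, ?_⟩
    have := h.isProbabilityMeasure h0
    have := h.isProbabilityMeasure ht
    have := Measure.isProbabilityMeasure_map (μ := curveMeasure p 0) hmeas.aemeasurable
    refine Measure.ext_of_Iic _ _ fun a => ?_
    obtain ⟨b, hb⟩ := h.exists_cdf_eq h0 (h.cdf_mem_Ioo ht a)
    have hpre : T t ⁻¹' Iic a = Iic b := by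
      ext x
      rw [mem_preimage, mem_Iic, mem_Iic, ← (h.strictMono_cdf ht).le_iff_le]
      simp only [hT t x ht, ← hb]
      exact (h.strictMono_cdf h0).le_iff_le
    rw [Measure.map_apply hmeas measurableSet_Iic, hpre, h.curveMeasure_Iic h0,
      h.curveMeasure_Iic ht, hb]

end IsDensityCurve

/-! ### The tempered curve -/

theorem rpow_le_one_add {a s : ℝ} (ha : 0 < a) (hs0 : 0 ≤ s) (hs1 : s ≤ 1) : a ^ s ≤ 1 + a := by
  rcases le_total a 1 with h | h
  · linarith [Real.rpow_le_one ha.le h hs0]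
  · have := Real.rpow_le_rpow_of_exponent_le h hs1
    rw [Real.rpow_one] at this
    linarith

theorem temperedZ_pos {π₀ L lam : ℝ → ℝ} {t : ℝ} (hπ₀ : ∀ x, 0 < π₀ x) (hL : ∀ x, 0 < L x)
    (hi : Integrable fun x => π₀ x * L x ^ lam t) : 0 < temperedZ π₀ L lam t := by
  have hpos : ∀ x, 0 < π₀ x * L x ^ lam t := fun x =>
    mul_pos (hπ₀ x) (Real.rpow_pos_of_pos (hL x) _)
  refine (integral_pos_iff_support_of_nonneg (fun x => (hpos x).le) hi).2 ?_
  have : Function.support (fun x => π₀ x * L x ^ lam t) = univ :=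
    eq_univ_of_forall fun x => (hpos x).ne'
  simp [this]

/-- The hypothesis on `log L` with respect to `π_t`, freed of the normalising constant. -/
theorem integrable_log_mul_of_curveMeasure {π₀ L lam : ℝ → ℝ} {t : ℝ}
    (hπ₀ : ∀ x, 0 < π₀ x) (hL : ∀ x, 0 < L x)
    (hc : Continuous fun x => π₀ x * L x ^ lam t) (hi : Integrable fun x => π₀ x * L x ^ lam t)
    (hI : Integrable (fun x => Real.log (L x)) (curveMeasure (tempered π₀ L lam) t)) :
    Integrable fun x => |Real.log (L x)| * (π₀ x * L x ^ lam t) := by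
  have hZ := temperedZ_pos hπ₀ hL hi
  have hp : ∀ x, 0 < π₀ x * L x ^ lam t := fun x =>
    mul_pos (hπ₀ x) (Real.rpow_pos_of_pos (hL x) _)
  rw [curveMeasure, integrable_withDensity_iff_integrable_smul'
    (by simp only [tempered]; exact (hc.div_const _).measurable.ennreal_ofReal) (by simp)] at hI
  refine (hI.norm.const_mul (temperedZ π₀ L lam t)).congr (Eventually.of_forall fun x => ?_)
  have hpx : 0 < tempered π₀ L lam t x := div_pos (hp x) hZ
  beta_reduce
  rw [ENNReal.toReal_ofReal hpx.le, smul_eq_mul, norm_mul, Real.norm_of_nonneg hpx.le,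
    Real.norm_eq_abs, tempered, temperedZ]
  rw [temperedZ] at hZ
  field_simp

/-- The tempered curve is a density curve. Since `λ(t) ∈ [0, 1]`, the bound `L ^ λ(t) ≤ 1 + L`
dominates `π₀ L ^ λ(t)` by `π₀ + π₀ L`. Integrability of `log L` under `π_0` and `π_1` says that
`|log L| (π₀ + π₀ L)` is integrable, which dominates the time derivative of `π₀ L ^ λ(t)` up to
the bound of `λ'`. The quotient by `Z` only costs constants, `Z` being `C¹` and positive on
`[0, 1]`. -/
theorem exists_isDensityCurve_tempered {π₀ L lam : ℝ → ℝ}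
    (hπ₀_smooth : ContDiff ℝ 1 π₀) (hπ₀_pos : ∀ x, 0 < π₀ x)
    (hL_smooth : ContDiff ℝ 1 L) (hL_pos : ∀ x, 0 < L x)
    (hπ₀_int : Integrable π₀) (hZ : Integrable fun x => π₀ x * L x)
    (hlam_smooth : ContDiffOn ℝ 1 lam (Icc 0 1))
    (hlam_mono : StrictMonoOn lam (Icc 0 1)) (hlam0 : lam 0 = 0) (hlam1 : lam 1 = 1)
    (hI : ∀ t ∈ Icc (0 : ℝ) 1, Integrable (fun x => Real.log (L x))
      (curveMeasure (tempered π₀ L lam) t)) :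
    ∃ q r, IsDensityCurve (tempered π₀ L lam) q r := by
  have hm0 : (0 : ℝ) ∈ Icc (0 : ℝ) 1 := left_mem_Icc.2 zero_le_one
  have hm1 : (1 : ℝ) ∈ Icc (0 : ℝ) 1 := right_mem_Icc.2 zero_le_one
  have hlam_nonneg : ∀ t ∈ Icc (0 : ℝ) 1, 0 ≤ lam t := fun t ht =>
    hlam0 ▸ hlam_mono.monotoneOn hm0 ht ht.1
  have hlam_le : ∀ t ∈ Icc (0 : ℝ) 1, lam t ≤ 1 := fun t ht =>
    hlam1 ▸ hlam_mono.monotoneOn ht hm1 ht.2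
  have hlamc := hlam_smooth.continuousOn
  set lam' := derivWithin lam (Icc 0 1) with hlam'
  have hlam'c : ContinuousOn lam' (Icc 0 1) :=
    hlam_smooth.continuousOn_derivWithin (uniqueDiffOn_Icc zero_lt_one) le_rfl
  have hlamd : ∀ t ∈ Icc (0 : ℝ) 1, HasDerivWithinAt lam (lam' t) (Icc 0 1) t := fun t ht =>
    (hlam_smooth.differentiableOn one_ne_zero t ht).hasDerivWithinAt
  have hπc := hπ₀_smooth.continuous
  have hLc := hL_smooth.continuous
  have hlogc : Continuous fun x => Real.log (L x) := hLc.log fun x => (hL_pos x).ne'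
  set N : ℝ → ℝ → ℝ := fun t x => π₀ x * L x ^ lam t with hN
  have hNpos : ∀ t x, 0 < N t x := fun t x =>
    mul_pos (hπ₀_pos x) (Real.rpow_pos_of_pos (hL_pos x) _)
  have hlam2 : ContinuousOn (fun z : ℝ × ℝ => lam z.2) (univ ×ˢ Icc 0 1) :=
    hlamc.comp continuousOn_snd fun z hz => hz.2
  have hlam'2 : ContinuousOn (fun z : ℝ × ℝ => lam' z.2) (univ ×ˢ Icc 0 1) :=
    hlam'c.comp continuousOn_snd fun z hz => hz.2
  have hL2 : ContinuousOn (fun z : ℝ × ℝ => L z.1) (univ ×ˢ Icc 0 1) :=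
    (hLc.comp continuous_fst).continuousOn
  have hNc : ContinuousOn (fun z : ℝ × ℝ => N z.2 z.1) (univ ×ˢ Icc 0 1) :=
    (hπc.comp continuous_fst).continuousOn.mul
      (hL2.rpow hlam2 fun z _ => Or.inl (hL_pos z.1).ne')
  set B : ℝ → ℝ := fun x => π₀ x + π₀ x * L x with hB
  have hBi : Integrable B := hπ₀_int.add hZ
  have hNB : ∀ t ∈ Icc (0 : ℝ) 1, ∀ x, |N t x| ≤ B x := fun t ht x => by
    rw [abs_of_pos (hNpos t x), hB, hN]
    simp only
    rw [← mul_one_add]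
    exact mul_le_mul_of_nonneg_left
      (rpow_le_one_add (hL_pos x) (hlam_nonneg t ht) (hlam_le t ht)) (hπ₀_pos x).le
  have hNi : ∀ t ∈ Icc (0 : ℝ) 1, Integrable (N t) := fun t ht =>
    integrable_slice hNc ⟨B, hBi, hNB⟩ ht
  -- the two summands of `B` are `N 0` and `N 1`
  have hlogB : Integrable fun x => |Real.log (L x)| * B x := by
    have e0 := integrable_log_mul_of_curveMeasure hπ₀_pos hL_pos (continuous_slice hNc hm0)
      (hNi 0 hm0) (hI 0 hm0)
    have e1 := integrable_log_mul_of_curveMeasure hπ₀_pos hL_pos (continuous_slice hNc hm1)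
      (hNi 1 hm1) (hI 1 hm1)
    refine (e0.add e1).congr (Eventually.of_forall fun x => ?_)
    simp only [hlam0, hlam1, Real.rpow_zero, Real.rpow_one, Pi.add_apply, hB]
    ring
  set N' : ℝ → ℝ → ℝ := fun t x => lam' t * Real.log (L x) * N t x with hN'
  have hN'c : ContinuousOn (fun z : ℝ × ℝ => N' z.2 z.1) (univ ×ˢ Icc 0 1) :=
    (hlam'2.mul (hlogc.comp continuous_fst).continuousOn).mul hNc
  have hNd : ∀ t ∈ Icc (0 : ℝ) 1, ∀ x,
      HasDerivWithinAt (fun s => N s x) (N' t x) (Icc 0 1) t := fun t ht x => by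
    refine (((hlamd t ht).const_rpow (hL_pos x)).const_mul (π₀ x)).congr_deriv ?_
    simp only [hN', hN]
    ring
  obtain ⟨Λ, hΛ⟩ := isCompact_Icc.exists_bound_of_continuousOn hlam'c
  have hN'B : ∀ t ∈ Icc (0 : ℝ) 1, ∀ x, |N' t x| ≤ Λ * (|Real.log (L x)| * B x) :=
    fun t ht x => by
      rw [hN', abs_mul, abs_mul, mul_assoc]
      exact mul_le_mul (hΛ t ht) (mul_le_mul_of_nonneg_left (hNB t ht x) (abs_nonneg _))
        (by positivity) ((norm_nonneg _).trans (hΛ t ht))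
  have hΛB := hlogB.const_mul Λ
  set Z := temperedZ π₀ L lam with hZdef
  set W : ℝ → ℝ := fun t => ∫ x, N' t x with hW
  have hZpos : ∀ t ∈ Icc (0 : ℝ) 1, 0 < Z t := fun t ht =>
    temperedZ_pos hπ₀_pos hL_pos (hNi t ht)
  have hZd : ∀ t ∈ Icc (0 : ℝ) 1, HasDerivWithinAt Z (W t) (Icc 0 1) t := fun t ht =>
    hasDerivWithinAt_integral_of_dominated (convex_Icc _ _) ht hNi hΛB hN'B hNd
  have hZc : ContinuousOn Z (Icc 0 1) := fun t ht => (hZd t ht).continuousWithinAt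
  have hWc : ContinuousOn W (Icc 0 1) :=
    continuousOn_of_dominated (fun t ht => (continuous_slice hN'c ht).aestronglyMeasurable)
      (fun t ht => Eventually.of_forall (hN'B t ht)) hΛB (Eventually.of_forall fun x =>
        hN'c.comp (f := fun t : ℝ => (x, t)) (by fun_prop) fun t ht => ⟨trivial, ht⟩)
  have hZ2 : ContinuousOn (fun z : ℝ × ℝ => Z z.2) (univ ×ˢ Icc 0 1) :=
    hZc.comp continuousOn_snd fun z hz => hz.2
  have hW2 : ContinuousOn (fun z : ℝ × ℝ => W z.2) (univ ×ˢ Icc 0 1) :=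
    hWc.comp continuousOn_snd fun z hz => hz.2
  obtain ⟨a, ha⟩ := isCompact_Icc.exists_bound_of_continuousOn
    (hZc.inv₀ fun t ht => (hZpos t ht).ne')
  obtain ⟨b, hb⟩ := isCompact_Icc.exists_bound_of_continuousOn
    (hWc.div (hZc.pow 2) fun t ht => pow_ne_zero 2 (hZpos t ht).ne')
  refine ⟨fun t x => (N' t x * Z t - N t x * W t) / Z t ^ 2,
    fun t x => (deriv π₀ x * L x ^ lam t + π₀ x * (deriv L x * lam t * L x ^ (lam t - 1))) / Z t,
    ⟨fun t ht x => div_pos (hNpos t x) (hZpos t ht), fun t ht => ?_, ?_, ?_, ?_, ?_, ?_, ?_, ?_⟩⟩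
  · simp only [tempered]
    rw [integral_div]
    exact div_self (hZpos t ht).ne'
  · exact hNc.div hZ2 fun z hz => (hZpos _ hz.2).ne'
  · exact ((hN'c.mul hZ2).sub (hNc.mul hW2)).div (hZ2.pow 2)
      fun z hz => pow_ne_zero 2 (hZpos _ hz.2).ne'
  · have hπ' : Continuous (deriv π₀) := hπ₀_smooth.continuous_deriv le_rfl
    have hL' : Continuous (deriv L) := hL_smooth.continuous_deriv le_rfl
    exact (((hπ'.comp continuous_fst).continuousOn.mul
      (hL2.rpow hlam2 fun z _ => Or.inl (hL_pos z.1).ne')).add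
      ((hπc.comp continuous_fst).continuousOn.mul
        (((hL'.comp continuous_fst).continuousOn.mul hlam2).mul
          (hL2.rpow (hlam2.sub continuousOn_const) fun z _ => Or.inl (hL_pos z.1).ne')))).div hZ2
      fun z hz => (hZpos _ hz.2).ne'
  · exact fun t ht x => (hNd t ht x).div (hZd t ht) (hZpos t ht).ne'
  · intro t ht x
    exact (((hπ₀_smooth.differentiable one_ne_zero) x).hasDerivAt.mul
      (((hL_smooth.differentiable one_ne_zero) x).hasDerivAt.rpow_const
        (Or.inl (hL_pos x).ne'))).div_const _
  · refine ⟨fun x => B x * a, hBi.mul_const a, fun t ht x => ?_⟩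
    rw [tempered, div_eq_mul_inv, abs_mul]
    exact mul_le_mul (hNB t ht x) (ha t ht) (abs_nonneg _) ((abs_nonneg _).trans (hNB t ht x))
  · refine ⟨fun x => Λ * (|Real.log (L x)| * B x) * a + B x * b,
      (hΛB.mul_const a).add (hBi.mul_const b), fun t ht x => ?_⟩
    have hz := (hZpos t ht).ne'
    have hsplit : (N' t x * Z t - N t x * W t) / Z t ^ 2 =
        N' t x * (Z t)⁻¹ - N t x * (W t / Z t ^ 2) := by
      field_simp
    rw [hsplit]
    refine (abs_sub _ _).trans ?_
    rw [abs_mul (N' t x), abs_mul (N t x)]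
    exact add_le_add
      (mul_le_mul (hN'B t ht x) (ha t ht) (abs_nonneg _) ((abs_nonneg _).trans (hN'B t ht x)))
      (mul_le_mul (hNB t ht x) (hb t ht) (abs_nonneg _) ((abs_nonneg _).trans (hNB t ht x)))

end FlowTransport

theorem proposition3p1
    (π₀ L lam : ℝ → ℝ)
    -- the prior density and the likelihood are positive and continuously differentiable
    (hπ₀_smooth : ContDiff ℝ 1 π₀) (hπ₀_pos : ∀ x, 0 < π₀ x)
    (hL_smooth : ContDiff ℝ 1 L) (hL_pos : ∀ x, 0 < L x)
    (hπ₀_int : MeasureTheory.Integrable π₀) (hπ₀_one : ∫ x, π₀ x = 1)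
    -- the marginal likelihood is finite
    (hZ : MeasureTheory.Integrable fun x => π₀ x * L x)
    -- the schedule
    (hlam_smooth : ContDiffOn ℝ 1 lam (Set.Icc 0 1))
    (hlam_mono : StrictMonoOn lam (Set.Icc 0 1)) (hlam0 : lam 0 = 0) (hlam1 : lam 1 = 1)
    -- the expected log-likelihood is finite along the curve
    (hI : ∀ t ∈ Set.Icc (0 : ℝ) 1, MeasureTheory.Integrable (fun x => Real.log (L x))
      (FlowTransport.curveMeasure (FlowTransport.tempered π₀ L lam) t))
    -- the tail decay, uniform in time
    (htail : ∃ ε : ℝ, 0 < ε ∧ ∃ C R : ℝ, ∀ t ∈ Set.Icc (0 : ℝ) 1, ∀ x : ℝ, R ≤ |x| →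
      |FlowTransport.drift (FlowTransport.tempered π₀ L lam) x t| *
        FlowTransport.tempered π₀ L lam t x ≤ C * |x| ^ (-1 - ε)) :
    FlowTransport.drift (FlowTransport.tempered π₀ L lam) ∈
        FlowTransport.weakLiouville (FlowTransport.tempered π₀ L lam) ∩
          FlowTransport.regularFields (FlowTransport.tempered π₀ L lam) ∧
    FlowTransport.TransportsByFlow (FlowTransport.drift (FlowTransport.tempered π₀ L lam))
        (FlowTransport.tempered π₀ L lam) ∧
    ∀ t ∈ Set.Icc (0 : ℝ) 1,
      (fun x => FlowTransport.drift (FlowTransport.tempered π₀ L lam) x t) ∈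
          FlowTransport.classicalLiouville (FlowTransport.tempered π₀ L lam) t ∧
      ((FlowTransport.finiteEnergySolutions (FlowTransport.tempered π₀ L lam) t).Nonempty →
        FlowTransport.argmin (FlowTransport.kineticEnergy (FlowTransport.tempered π₀ L lam) t)
            (FlowTransport.finiteEnergySolutions (FlowTransport.tempered π₀ L lam) t) =
          {fun x => FlowTransport.drift (FlowTransport.tempered π₀ L lam) x t}) := by
  obtain ⟨q, r, h⟩ := FlowTransport.exists_isDensityCurve_tempered hπ₀_smooth hπ₀_pos hL_smooth
    hL_pos hπ₀_int hZ hlam_smooth hlam_mono hlam0 hlam1 hI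
  exact ⟨⟨h.drift_mem_weakLiouville, h.drift_mem_regularFields htail⟩, h.transportsByFlow,
    fun t ht => ⟨h.drift_mem_classicalLiouville ht, h.argmin_kineticEnergy ht⟩⟩
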